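/- Let $n,p\ge 0$ be integers and let $(M^{2n},g,J)$ be a Kaehler manifold of real dimension $2n$, that is, a smooth Riemannian manifold with a smooth almost complex structure $J$ ($J^2=-I$) which is orthogonal with respect to $g$ and parallel with respect to the Levi-Civita connection. Let $f\colon M^{2n}\to\mathbb{R}^{2n+p}$ be a smooth isometric immersion, with normal spaces $N_fM(x)$ and second fundamental form $\alpha\colon T_xM\times T_xM\to N_fM(x)$. For a subspace $U\subset N_fM(x)$ let $\pi_U$ be the orthogonal projection onto $U$ and put $\mathcal{N}(\alpha_U)=\{X\in T_xM:\pi_U\,\alpha(X,Y)=0\text{ for all }Y\in T_xM\}$. For $1\le s\le p$ the complex $s$-nullity of $f$ at $x$ is $$\nu^c_s(x)=\max\{\dim(\mathcal{N}(\alpha_U)\cap J\mathcal{N}(\alpha_U)) : U\subset N_fM(x),\ \dim U=s\}.$$ Assume that $\nu^c_s(x)<2(n-s)$ for every $x\in M$ and every $1\le s\le p$. Then $f$ is minimal, that is, its mean curvature vector (the normalized trace of $\alpha$ with respect to $g$) vanishes at every point. Moreover, $\alpha(X,JY)=\alpha(JX,Y)$ for all $x\in M$ and all $X,Y\in T_xM$.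 -/

import Mathlib

open Bundle
open scoped Manifold ContDiff InnerProductSpace

noncomputable section

namespace RealKaehler

/-- Euclidean space `ℝ^m`. -/
abbrev Euc (m : ℕ) : Type := EuclideanSpace ℝ (Fin m)

section Definitions

variable {m q : ℕ} {M : Type*} [TopologicalSpace M] [ChartedSpace (Euc m) M]

/-- The tangent space `T_x M` of the `m`-dimensional manifold `M`. -/
abbrev Tan (m : ℕ) {M : Type*} [TopologicalSpace M] [ChartedSpace (Euc m) M] (x : M) : Type :=
  TangentSpace 𝓘(ℝ, Euc m) x

/-- A smooth Riemannian metric on the smooth manifold `M` of dimension `m`. -/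
abbrev Metric (m : ℕ) (M : Type*) [TopologicalSpace M] [ChartedSpace (Euc m) M]
    [IsManifold 𝓘(ℝ, Euc m) ∞ M] :=
  ContMDiffRiemannianMetric 𝓘(ℝ, Euc m) ∞ (Euc m) (fun x : M => Tan m x)

/-! ### Coordinate expressions in the chart `φ = extChartAt 𝓘(ℝ, Euc m) x₀`, with `ψ = φ⁻¹` -/

/-- The differential `dφ_x : T_x M → ℝ^m` of the chart `φ` around `x₀`. -/
def dChart (x₀ x : M) : Tan m x →L[ℝ] Euc m :=
  mfderiv 𝓘(ℝ, Euc m) 𝓘(ℝ, Euc m) (extChartAt 𝓘(ℝ, Euc m) x₀) x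

/-- The differential `dψ_z : ℝ^m → T_{ψ(z)} M` of the parametrization `ψ = φ⁻¹`; it sends the
`i`-th standard basis vector to the coordinate vector `∂_i`. -/
def dParam (x₀ : M) (z : Euc m) : Euc m →L[ℝ] Tan m ((extChartAt 𝓘(ℝ, Euc m) x₀).symm z) :=
  mfderiv 𝓘(ℝ, Euc m) 𝓘(ℝ, Euc m) (extChartAt 𝓘(ℝ, Euc m) x₀).symm z

/-- The metric in the chart: `G_z(u, v) = g(dψ_z u, dψ_z v)`. -/
def metricInChart [IsManifold 𝓘(ℝ, Euc m) ∞ M] (g : Metric m M) (x₀ : M) (z : Euc m) :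
    Euc m →L[ℝ] Euc m →L[ℝ] ℝ :=
  (ContinuousLinearMap.precomp ℝ (dParam x₀ z)).comp
    ((g.inner ((extChartAt 𝓘(ℝ, Euc m) x₀).symm z)).comp (dParam x₀ z))

/-- A field of endomorphisms in the chart: `dφ ∘ J ∘ dψ`. -/
def endInChart (J : ∀ x : M, Tan m x →L[ℝ] Tan m x) (x₀ : M) (z : Euc m) : Euc m →L[ℝ] Euc m :=
  (dChart x₀ ((extChartAt 𝓘(ℝ, Euc m) x₀).symm z)).comp
    ((J ((extChartAt 𝓘(ℝ, Euc m) x₀).symm z)).comp (dParam x₀ z))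

/-- The Christoffel symbols of the first kind, as a linear form in the last argument:
`w ↦ (D_u G(v, w) + D_v G(u, w) - D_w G(u, v)) / 2`. -/
def christoffelFirst [IsManifold 𝓘(ℝ, Euc m) ∞ M] (g : Metric m M) (x₀ : M) (z u v : Euc m) :
    Euc m →L[ℝ] ℝ :=
  (1 / 2 : ℝ) • (fderiv ℝ (fun y => metricInChart g x₀ y v) z u
    + fderiv ℝ (fun y => metricInChart g x₀ y u) z v
    - fderiv ℝ (fun y => metricInChart g x₀ y u v) z)

/-- The Christoffel symbols `Γ_z(u, v)` of the Levi-Civita connection: the vector which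
corresponds to `christoffelFirst` under the isomorphism `w ↦ G_z(w, ·)` of `ℝ^m` with its dual.
The Levi-Civita connection is `∇_u v = D_u v + Γ(u, v)` in the chart. -/
def christoffel [IsManifold 𝓘(ℝ, Euc m) ∞ M] (g : Metric m M) (x₀ : M) (z u v : Euc m) : Euc m :=
  (metricInChart g x₀ z).inverse (christoffelFirst g x₀ z u v)

/-- The covariant derivative `(∇_u J) v = (D_u J) v + Γ(u, J v) - J Γ(u, v)` in the chart. -/
def covDerivEnd [IsManifold 𝓘(ℝ, Euc m) ∞ M] (g : Metric m M)
    (J : ∀ x : M, Tan m x →L[ℝ] Tan m x) (x₀ : M) (z u v : Euc m) : Euc m :=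
  fderiv ℝ (endInChart J x₀) z u v + christoffel g x₀ z u (endInChart J x₀ z v)
    - endInChart J x₀ z (christoffel g x₀ z u v)

/-- `(M, g, J)` is a Kaehler manifold: `J` is a smooth almost complex structure which is
orthogonal with respect to `g` and parallel with respect to the Levi-Civita connection. -/
structure IsKaehler [IsManifold 𝓘(ℝ, Euc m) ∞ M] (g : Metric m M)
    (J : ∀ x : M, Tan m x →L[ℝ] Tan m x) : Prop where
  smooth : ContMDiff 𝓘(ℝ, Euc m) (𝓘(ℝ, Euc m).prod 𝓘(ℝ, Euc m →L[ℝ] Euc m)) ∞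
    (fun x : M => TotalSpace.mk' (Euc m →L[ℝ] Euc m)
      (E := fun x : M => Tan m x →L[ℝ] Tan m x) x (J x))
  sq : ∀ (x : M) (X : Tan m x), J x (J x X) = -X
  orthogonal : ∀ (x : M) (X Y : Tan m x), g.inner x (J x X) (J x Y) = g.inner x X Y
  parallel : ∀ x₀ : M, ∀ z ∈ (extChartAt 𝓘(ℝ, Euc m) x₀).target, ∀ u v : Euc m,
    covDerivEnd g J x₀ z u v = 0

/-- The differential `df_x : T_x M → ℝ^q`. -/
def diff (f : M → Euc q) (x : M) : Tan m x →L[ℝ] Euc q :=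
  mfderiv 𝓘(ℝ, Euc m) 𝓘(ℝ, Euc q) f x

/-- `f : (M, g) → ℝ^q` is a smooth isometric immersion. -/
structure IsIsometricImmersion [IsManifold 𝓘(ℝ, Euc m) ∞ M] (g : Metric m M) (f : M → Euc q) :
    Prop where
  smooth : ContMDiff 𝓘(ℝ, Euc m) 𝓘(ℝ, Euc q) ∞ f
  isometric : ∀ (x : M) (X Y : Tan m x), ⟪diff f x X, diff f x Y⟫_ℝ = g.inner x X Y

/-- The normal space `N_f M(x)`, the orthogonal complement of the image of `df_x`. -/
def normalSpace (m : ℕ) {M : Type*} [TopologicalSpace M] [ChartedSpace (Euc m) M]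
    (f : M → Euc q) (x : M) : Submodule ℝ (Euc q) :=
  (LinearMap.range (diff (m := m) f x).toLinearMap)ᗮ

/-- The second fundamental form `α : T_x M × T_x M → N_f M(x)`: the normal component of the
second derivative of `f` in the chart around `x`. -/
def secondFundamentalForm (f : M → Euc q) (x : M) : Tan m x →ₗ[ℝ] Tan m x →ₗ[ℝ] Euc q :=
  LinearMap.mk₂ ℝ
    (fun X Y => (normalSpace m f x).starProjection
      (fderiv ℝ (fderiv ℝ (f ∘ (extChartAt 𝓘(ℝ, Euc m) x).symm)) (extChartAt 𝓘(ℝ, Euc m) x x)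
        (dChart x x X) (dChart x x Y)))
    (by intros; simp only [map_add, add_apply])
    (by intros; simp only [map_smul, smul_apply])
    (by intros; simp only [map_add])
    (by intros; simp only [map_smul])

/-- The null space `N(α_U) = {X | π_U α(X, Y) = 0 for all Y}`, where `π_U` is the orthogonal
projection onto `U`. -/
def nullSpace (f : M → Euc q) (x : M) (U : Submodule ℝ (Euc q)) : Submodule ℝ (Tan m x) :=
  LinearMap.ker ((secondFundamentalForm f x).compr₂ U.starProjection.toLinearMap)

/-- The complex `s`-nullity of `f` at `x`: the maximum, over the `s`-dimensional subspaces `U` of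
`N_f M(x)`, of `dim (N(α_U) ∩ J N(α_U))`. -/
def complexNullity (J : ∀ x : M, Tan m x →L[ℝ] Tan m x) (f : M → Euc q) (s : ℕ) (x : M) : ℕ :=
  sSup {d : ℕ | ∃ U : Submodule ℝ (Euc q), U ≤ normalSpace m f x ∧ Module.finrank ℝ U = s ∧
    d = Module.finrank ℝ
      ↥(nullSpace f x U ⊓ (nullSpace f x U).map (J x).toLinearMap : Submodule ℝ (Tan m x))}

/-- The Gram matrix of the metric at `x` in the standard basis of `T_x M`. -/
def gram [IsManifold 𝓘(ℝ, Euc m) ∞ M] (g : Metric m M) (x : M) : Matrix (Fin m) (Fin m) ℝ :=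
  Matrix.of fun i j =>
    g.inner x (EuclideanSpace.single i (1 : ℝ) : Euc m) (EuclideanSpace.single j (1 : ℝ) : Euc m)

/-- The mean curvature vector `H = (1/m) ∑ g^{ij} α(b_i, b_j)` at `x`, the normalized trace of the
second fundamental form with respect to the metric. -/
def meanCurvature [IsManifold 𝓘(ℝ, Euc m) ∞ M] (g : Metric m M) (f : M → Euc q) (x : M) : Euc q :=
  (1 / (m : ℝ)) • ∑ i : Fin m, ∑ j : Fin m, (gram g x)⁻¹ i j •
    secondFundamentalForm (m := m) f x
      (EuclideanSpace.single i (1 : ℝ) : Euc m) (EuclideanSpace.single j (1 : ℝ) : Euc m)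

/-- `f` is minimal: its mean curvature vector vanishes everywhere. -/
def IsMinimal [IsManifold 𝓘(ℝ, Euc m) ∞ M] (g : Metric m M) (f : M → Euc q) : Prop :=
  ∀ x : M, meanCurvature g f x = 0

end Definitions

end RealKaehler

end

/-! Fix a point and put `A(X, Y) = α(X, Y) + α(JX, JY)`. Both conclusions follow from `A = 0`.
Replacing `Y` by `JY` gives `α(X, JY) = α(JX, Y)`, and since `J` is an isometry of `g`, the trace of
`α` equals that of `α(J·, J·) = -α`, so it vanishes (`isMinimal_of_hermitianPart_eq_zero`).

The Gauss equation and the `J`-invariance of Kaehler curvature (`IsKaehler.isKaehlerFlat`) say that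
`Y ↦ (A(X, Y), A(X, JY))` is a flat bilinear form for the indefinite product `⟨a, c⟩ - ⟨b, d⟩` on
pairs. Let `U` be the span of the values of `A` and `s = dim U`. By
`IsKaehlerFlat.exists_hermitianKer`, the null space of `A` contains a `J`-invariant `K` of dimension
at least `2n - 2s`: the kernel of the form at a generic `X` already annihilates every vector. By
`IsKaehlerFlat.inner_hermitianSpan`, `α(Z, Y)` is orthogonal to `U` for `Y ∈ K`, so `K` lies in
`N(α_U) ∩ J N(α_U)`. If `s ≥ 1` this contradicts the bound on the complex `s`-nullity; hence `U = 0`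
and `A = 0`. -/

namespace RealKaehler

/-! ### Flat bilinear forms and the Hermitian part of `α` -/

section Algebra

variable {V E : Type*} [AddCommGroup V] [Module ℝ V] [NormedAddCommGroup E] [InnerProductSpace ℝ E]

/-- The `J`-Hermitian part `A(X, Y) = α(X, Y) + α(JX, JY)` of a bilinear form. -/
def hermitianPart (α : V →ₗ[ℝ] V →ₗ[ℝ] E) (J : V →ₗ[ℝ] V) : V →ₗ[ℝ] V →ₗ[ℝ] E :=
  α + α.compl₁₂ J J

@[simp]
theorem hermitianPart_apply (α : V →ₗ[ℝ] V →ₗ[ℝ] E) (J : V →ₗ[ℝ] V) (X Y : V) :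
    hermitianPart α J X Y = α X Y + α (J X) (J Y) := rfl

/-- The Gauss equation together with the invariance `R(X, Y, JZ, JW) = R(X, Y, Z, W)` of the
curvature tensor. -/
def IsKaehlerFlat (α : V →ₗ[ℝ] V →ₗ[ℝ] E) (J : V →ₗ[ℝ] V) : Prop :=
  ∀ X Y Z W, ⟪α X Z, α Y W⟫_ℝ - ⟪α Y Z, α X W⟫_ℝ =
    ⟪α X (J Z), α Y (J W)⟫_ℝ - ⟪α Y (J Z), α X (J W)⟫_ℝ

variable {α : V →ₗ[ℝ] V →ₗ[ℝ] E} {J : V →ₗ[ℝ] V}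

/-- Sum of the curvature identity at `(X, Z, Y, W)` and at `(JX, Z, JY, W)`. Symmetry of `α` is not
involved. -/
theorem IsKaehlerFlat.mixed (h : IsKaehlerFlat α J)
    (hJ : ∀ X, J (J X) = -X) (X Y Z W : V) :
    ⟪hermitianPart α J X Y, α Z W⟫_ℝ - ⟪hermitianPart α J X (J Y), α Z (J W)⟫_ℝ =
      ⟪hermitianPart α J X W, α Z Y⟫_ℝ - ⟪hermitianPart α J X (J W), α Z (J Y)⟫_ℝ := by
  have h1 := h X Z Y W
  have h2 := h (J X) Z (J Y) W
  have e1 := real_inner_comm (α Z Y) (α X W)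
  have e2 := real_inner_comm (α Z (J Y)) (α X (J W))
  have e3 := real_inner_comm (α Z Y) (α (J X) (J W))
  have e4 := real_inner_comm (α Z (J Y)) (α (J X) W)
  simp only [hermitianPart_apply, hJ, map_neg, inner_add_left, inner_neg_left]
    at h1 h2 ⊢
  linarith

/-- Flatness of `(A(X, Y), A(X, JY))` for the split product: `mixed` is symmetrized in its second
factor by adding the instance at `(X, JY, JZ, W)`. -/
theorem IsKaehlerFlat.hermitian (h : IsKaehlerFlat α J)
    (hJ : ∀ X, J (J X) = -X) (X Y Z W : V) :
    ⟪hermitianPart α J X Y, hermitianPart α J Z W⟫_ℝ -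
        ⟪hermitianPart α J X (J Y), hermitianPart α J Z (J W)⟫_ℝ =
      ⟪hermitianPart α J X W, hermitianPart α J Z Y⟫_ℝ -
        ⟪hermitianPart α J X (J W), hermitianPart α J Z (J Y)⟫_ℝ := by
  have h1 := h.mixed hJ X Y Z W
  have h2 := h.mixed hJ X (J Y) (J Z) W
  rw [hermitianPart_apply α J Z W, hermitianPart_apply α J Z (J W), hermitianPart_apply α J Z Y,
    hermitianPart_apply α J Z (J Y)]
  simp only [hJ, map_neg, inner_add_right, inner_neg_left, inner_neg_right] at h1 h2 ⊢
  linarith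

/-- The vectors `Y` with `A(X, Y) = 0 = A(X, JY)`, for `A` the Hermitian part. -/
def hermitianKer (α : V →ₗ[ℝ] V →ₗ[ℝ] E) (J : V →ₗ[ℝ] V) (X : V) : Submodule ℝ V :=
  LinearMap.ker (hermitianPart α J X) ⊓ LinearMap.ker (hermitianPart α J X ∘ₗ J)

theorem mem_hermitianKer {X Y : V} : Y ∈ hermitianKer α J X ↔
    hermitianPart α J X Y = 0 ∧ hermitianPart α J X (J Y) = 0 := Iff.rfl

theorem hermitianPart_symm (hs : ∀ X Y, α X Y = α Y X) (X Y : V) :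
    hermitianPart α J X Y = hermitianPart α J Y X := by
  simp [hs X Y, hs (J X) (J Y)]

theorem hermitianPart_J_swap (hs : ∀ X Y, α X Y = α Y X) (hJ : ∀ X, J (J X) = -X) (X Y : V) :
    hermitianPart α J X (J Y) = -hermitianPart α J Y (J X) := by
  simp [hs X (J Y), hs (J X) Y, hJ]

theorem hermitianPart_J_self (hs : ∀ X Y, α X Y = α Y X) (hJ : ∀ X, J (J X) = -X) (X : V) :
    hermitianPart α J X (J X) = 0 := by
  simp [hs X (J X), hJ]

theorem J_mem_hermitianKer (hJ : ∀ X, J (J X) = -X) {X Y : V} (hY : Y ∈ hermitianKer α J X) :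
    J Y ∈ hermitianKer α J X := by
  rw [mem_hermitianKer] at hY ⊢
  exact ⟨hY.2, by rw [hJ, map_neg, hY.1, neg_zero]⟩

/-- The sign change in `A(Y, JX) = -A(X, JY)` turns the indefinite product into a sum of squares;
this positivity makes `A(Y, Y) = 0` force `A(·, Y) = 0`. -/
theorem IsKaehlerFlat.inner_self (h : IsKaehlerFlat α J) (hs : ∀ X Y, α X Y = α Y X)
    (hJ : ∀ X, J (J X) = -X) (X Y : V) :
    ⟪hermitianPart α J X X, hermitianPart α J Y Y⟫_ℝ =
      ‖hermitianPart α J X Y‖ ^ 2 + ‖hermitianPart α J X (J Y)‖ ^ 2 := by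
  have := h.hermitian hJ X X Y Y
  rw [hermitianPart_symm hs Y X, hermitianPart_J_swap hs hJ Y X, hermitianPart_J_self hs hJ,
    inner_zero_left, inner_neg_right, real_inner_self_eq_norm_sq, real_inner_self_eq_norm_sq] at this
  linarith

theorem IsKaehlerFlat.eq_zero_of_self (h : IsKaehlerFlat α J) (hs : ∀ X Y, α X Y = α Y X)
    (hJ : ∀ X, J (J X) = -X) {Y : V} (hY : hermitianPart α J Y Y = 0) (X : V) :
    hermitianPart α J X Y = 0 := by
  have := h.inner_self hs hJ X Y
  rw [hY, inner_zero_right] at this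
  have h2 : ‖hermitianPart α J X Y‖ ^ 2 = 0 := by
    nlinarith [sq_nonneg ‖hermitianPart α J X Y‖, sq_nonneg ‖hermitianPart α J X (J Y)‖]
  simpa using h2

theorem IsKaehlerFlat.hermitianKer_add_le (h : IsKaehlerFlat α J) (hs : ∀ X Y, α X Y = α Y X)
    (hJ : ∀ X, J (J X) = -X) {X Y : V} (hY : Y ∈ hermitianKer α J X) :
    hermitianKer α J (X + Y) ≤ hermitianKer α J X ⊓ hermitianKer α J Y := by
  intro Z hZ
  rw [mem_hermitianKer] at hZ hY
  -- The side containing `A(X, Y)` and `A(X, JY)` vanishes. On the other side, `Z ∈ ker(X + Y)`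
  -- gives `A(Y, Z) = -A(X, Z)` and `A(Y, JZ) = -A(X, JZ)`, leaving minus a sum of two squares.
  have key := h.hermitian hJ X Z Z Y
  rw [hY.1, hY.2, hermitianPart_symm hs Z Y, hermitianPart_J_swap hs hJ Z Y, inner_zero_left,
    inner_zero_left, inner_neg_right] at key
  simp only [map_add, LinearMap.add_apply] at hZ
  have e1 := eq_neg_of_add_eq_zero_right hZ.1
  have e2 := eq_neg_of_add_eq_zero_right hZ.2
  rw [e1, e2, inner_neg_right, inner_neg_right, real_inner_self_eq_norm_sq,
    real_inner_self_eq_norm_sq] at key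
  have h1 : hermitianPart α J X Z = 0 := by
    have : ‖hermitianPart α J X Z‖ ^ 2 = 0 := by
      nlinarith [sq_nonneg ‖hermitianPart α J X Z‖, sq_nonneg ‖hermitianPart α J X (J Z)‖]
    simpa using this
  have h2 : hermitianPart α J X (J Z) = 0 := by
    have : ‖hermitianPart α J X (J Z)‖ ^ 2 = 0 := by
      nlinarith [sq_nonneg ‖hermitianPart α J X Z‖, sq_nonneg ‖hermitianPart α J X (J Z)‖]
    simpa using this
  rw [h1, neg_zero] at e1
  rw [h2, neg_zero] at e2
  exact ⟨⟨h1, h2⟩, ⟨e1, e2⟩⟩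

/-- The real span of the values `A(X, X)`. -/
def hermitianSpan (α : V →ₗ[ℝ] V →ₗ[ℝ] E) (J : V →ₗ[ℝ] V) : Submodule ℝ E :=
  Submodule.span ℝ (Set.range fun X => hermitianPart α J X X)

theorem hermitianPart_mem_span (hs : ∀ X Y, α X Y = α Y X) (X Y : V) :
    hermitianPart α J X Y ∈ hermitianSpan α J := by
  have hm : ∀ Z, hermitianPart α J Z Z ∈ hermitianSpan α J := fun Z =>
    Submodule.subset_span ⟨Z, rfl⟩
  have e : hermitianPart α J X Y = (1 / 2 : ℝ) • (hermitianPart α J (X + Y) (X + Y)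
      - hermitianPart α J X X - hermitianPart α J Y Y) := by
    have := hermitianPart_symm (J := J) hs X Y
    simp only [map_add, LinearMap.add_apply, ← this]
    module
  rw [e]
  exact Submodule.smul_mem _ _ (Submodule.sub_mem _ (Submodule.sub_mem _ (hm _) (hm _)) (hm _))

/-- Rank-nullity for `Y ↦ (A(X, Y), A(X, JY))` with values in two copies of the span, whence the
factor `2`. -/
theorem finrank_le_hermitianKer [FiniteDimensional ℝ V] [FiniteDimensional ℝ E]
    (hs : ∀ X Y, α X Y = α Y X) (X : V) :
    Module.finrank ℝ V ≤
      Module.finrank ℝ (hermitianKer α J X) + 2 * Module.finrank ℝ (hermitianSpan α J) := by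
  let B : V →ₗ[ℝ] hermitianSpan α J :=
    (hermitianPart α J X).codRestrict _ (hermitianPart_mem_span hs X)
  let T : V →ₗ[ℝ] (hermitianSpan α J × hermitianSpan α J) := B.prod (B ∘ₗ J)
  have hk : LinearMap.ker T = hermitianKer α J X := by
    ext Y
    simp [T, B, mem_hermitianKer]
  have h1 := LinearMap.finrank_range_add_finrank_ker T
  have h2 := Submodule.finrank_le (LinearMap.range T)
  rw [Module.finrank_prod] at h2
  rw [hk] at h1
  omega

/-- The kernel of the Hermitian part of a flat form has small codimension. -/
theorem IsKaehlerFlat.exists_hermitianKer [FiniteDimensional ℝ V] [FiniteDimensional ℝ E]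
    (h : IsKaehlerFlat α J) (hs : ∀ X Y, α X Y = α Y X) (hJ : ∀ X, J (J X) = -X) :
    ∃ K : Submodule ℝ V, (∀ Y ∈ K, J Y ∈ K) ∧ (∀ X, ∀ Y ∈ K, hermitianPart α J X Y = 0) ∧
      Module.finrank ℝ V ≤ Module.finrank ℝ K + 2 * Module.finrank ℝ (hermitianSpan α J) := by
  -- A regular element: `X` minimizes the dimension of the kernel. For `Y` in that kernel, `ker(X +
  -- Y) ⊆ ker X` is then an equality, so `Y ∈ ker(X + Y) ⊆ ker Y` and `A(Y, Y) = 0`.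
  obtain ⟨_, ⟨X, rfl⟩, hX⟩ := wellFounded_lt.has_min
    (Set.range fun X => Module.finrank ℝ (hermitianKer α J X)) (Set.range_nonempty _)
  refine ⟨hermitianKer α J X, fun Y hY => J_mem_hermitianKer hJ hY, fun Z Y hY => ?_,
    finrank_le_hermitianKer hs X⟩
  have hle := h.hermitianKer_add_le hs hJ hY
  have heq : hermitianKer α J (X + Y) = hermitianKer α J X :=
    Submodule.eq_of_le_of_finrank_le (hle.trans inf_le_left) (not_lt.1 (hX _ ⟨X + Y, rfl⟩))
  have hYY : Y ∈ hermitianKer α J Y := (hle (heq ▸ hY)).2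
  exact h.eq_zero_of_self hs hJ (mem_hermitianKer.1 hYY).1 Z

theorem IsKaehlerFlat.inner_hermitianSpan (h : IsKaehlerFlat α J) (hs : ∀ X Y, α X Y = α Y X)
    (hJ : ∀ X, J (J X) = -X) {Y : V} (hY : ∀ X, hermitianPart α J X Y = 0)
    (hY' : ∀ X, hermitianPart α J X (J Y) = 0) (Z : V) {u : E} (hu : u ∈ hermitianSpan α J) :
    ⟪u, α Z Y⟫_ℝ = 0 := by
  induction hu using Submodule.span_induction with
  | mem u hu =>
    obtain ⟨X, rfl⟩ := hu
    -- With `W = X`, every term but `⟨A(X, X), α(Z, Y)⟩` contains `A(X, Y)`, `A(X, JY)` or `A(X,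
    -- JX)`, all zero.
    have := h.mixed hJ X Y Z X
    rw [hY, hY', inner_zero_left, inner_zero_left, hermitianPart_J_self hs hJ, inner_zero_left]
      at this
    simpa using this.symm
  | zero => simp
  | add u v _ _ hu hv => rw [inner_add_left, hu, hv, add_zero]
  | smul c u _ hu => rw [real_inner_smul_left, hu, mul_zero]

theorem hermitianPart_eq_zero_of_span (hs : ∀ X Y, α X Y = α Y X) (h : hermitianSpan α J = ⊥)
    (X Y : V) : hermitianPart α J X Y = 0 := by
  simpa [h] using hermitianPart_mem_span (J := J) hs X Y

end Algebra

/-! ### The Gauss equation with `J`-invariant curvature, in coordinates -/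

section Local

variable {H E : Type*} [NormedAddCommGroup H] [NormedSpace ℝ H]
  [NormedAddCommGroup E] [InnerProductSpace ℝ E]

theorem starProjection_orthogonal_eq_sub {K : Submodule ℝ E} [K.HasOrthogonalProjection] {x y : E}
    (hy : y ∈ K) (hxy : ∀ k ∈ K, ⟪x - y, k⟫_ℝ = 0) : Kᗮ.starProjection x = x - y := by
  refine Submodule.eq_starProjection_of_mem_orthogonal' (z := y) ?_ ?_ ?_
  · exact (Submodule.mem_orthogonal' _ _).2 hxy
  · exact K.le_orthogonal_orthogonal hy
  · abel

/-- The antisymmetrized derivative of `⟨D_u a, b⟩` contains no second derivatives. -/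
theorem fderiv_inner_fderiv_sub {a b : H → E} {z : H} (ha : ContDiffAt ℝ 2 a z)
    (hb : ContDiffAt ℝ 1 b z) (u v : H) :
    fderiv ℝ (fun y => ⟪fderiv ℝ a y u, b y⟫_ℝ) z v -
        fderiv ℝ (fun y => ⟪fderiv ℝ a y v, b y⟫_ℝ) z u =
      ⟪fderiv ℝ a z u, fderiv ℝ b z v⟫_ℝ - ⟪fderiv ℝ a z v, fderiv ℝ b z u⟫_ℝ := by
  have hd : DifferentiableAt ℝ (fderiv ℝ a) z :=
    (ha.fderiv_right (m := 1) (by norm_num)).differentiableAt (by norm_num)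
  have hbd : DifferentiableAt ℝ b z := hb.differentiableAt (by norm_num)
  have hs : IsSymmSndFDerivAt ℝ a z := ha.isSymmSndFDerivAt (by simp)
  have key : ∀ w w' : H, fderiv ℝ (fun y => ⟪fderiv ℝ a y w, b y⟫_ℝ) z w' =
      ⟪fderiv ℝ a z w, fderiv ℝ b z w'⟫_ℝ + ⟪fderiv ℝ (fderiv ℝ a) z w' w, b z⟫_ℝ := by
    intro w w'
    rw [fderiv_inner_apply ℝ (hd.clm_apply (differentiableAt_const w)) hbd]
    rw [fderiv_clm_apply hd (differentiableAt_const w)]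
    simp
  rw [key, key, hs.eq v u]
  ring

set_option synthInstance.maxHeartbeats 400000 in
theorem differentiableAt_inner_pullback {D : H → H →L[ℝ] E} {z : H} (hD : DifferentiableAt ℝ D z) :
    DifferentiableAt ℝ (fun y => ((ContinuousLinearMap.compL ℝ H E ℝ).flip (D y)).comp
      ((innerSL ℝ).comp (D y))) z :=
  (((ContinuousLinearMap.compL ℝ H E ℝ).flip.differentiableAt).comp z hD).clm_comp
    ((differentiableAt_const _).clm_comp hD)

/-- If `J` is parallel in the coordinates given by a parametrized submanifold `F`, its second
fundamental form satisfies the Gauss equation with `J`-invariant curvature. -/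
theorem kaehler_gauss_of_local [FiniteDimensional ℝ H] {F : H → E} {Jc : H → H →L[ℝ] H}
    {Γ : H → H → H → H} {z : H} (hF : ContDiffAt ℝ 3 F z) (hJ : ContDiffAt ℝ 2 Jc z)
    (horth : ∀ᶠ y in nhds z, ∀ v w, ⟪fderiv ℝ F y (Jc y v), fderiv ℝ F y (Jc y w)⟫_ℝ =
      ⟪fderiv ℝ F y v, fderiv ℝ F y w⟫_ℝ)
    (hΓ : ∀ᶠ y in nhds z, ∀ u v w, ⟪fderiv ℝ (fderiv ℝ F) y u v, fderiv ℝ F y w⟫_ℝ =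
      ⟪fderiv ℝ F y (Γ y u v), fderiv ℝ F y w⟫_ℝ)
    (hpar : ∀ᶠ y in nhds z, ∀ u v, fderiv ℝ Jc y u v + Γ y u (Jc y v) - Jc y (Γ y u v) = 0)
    {a : H → H → E} (hα : ∀ u v, a u v =
      (LinearMap.range (fderiv ℝ F z).toLinearMap)ᗮ.starProjection
        (fderiv ℝ (fderiv ℝ F) z u v)) (u u' v w : H) :
    ⟪a u v, a u' w⟫_ℝ - ⟪a u' v, a u w⟫_ℝ =
      ⟪a u (Jc z v), a u' (Jc z w)⟫_ℝ - ⟪a u' (Jc z v), a u (Jc z w)⟫_ℝ := by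
  have hF1 : ContDiffAt ℝ 2 (fderiv ℝ F) z := hF.fderiv_right (by norm_num)
  have hE : ∀ v, ContDiffAt ℝ 2 (fun y => fderiv ℝ F y v) z := fun v =>
    hF1.clm_apply contDiffAt_const
  have hP : ∀ v, ContDiffAt ℝ 2 (fun y => fderiv ℝ F y (Jc y v)) z := fun v =>
    hF1.clm_apply (hJ.clm_apply contDiffAt_const)
  have hFd : ∀ᶠ y in nhds z, DifferentiableAt ℝ (fderiv ℝ F) y := by
    filter_upwards [hF1.eventually (by simp)] with y hy using hy.differentiableAt (by norm_num)
  have hJd : ∀ᶠ y in nhds z, DifferentiableAt ℝ Jc y := by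
    filter_upwards [hJ.eventually (by simp)] with y hy using hy.differentiableAt (by norm_num)
  have dE : ∀ᶠ y in nhds z, ∀ u v, fderiv ℝ (fun y => fderiv ℝ F y v) y u =
      fderiv ℝ (fderiv ℝ F) y u v := by
    filter_upwards [hFd] with y hy u v
    rw [fderiv_clm_apply hy (differentiableAt_const v)]
    simp
  -- Parallelism eliminates the derivative of `Jc`: the result is the normal part of `D²F(u, Jv)`
  -- plus the tangential vector `dF(J Γ(u, v))`.
  have dP : ∀ᶠ y in nhds z, ∀ u v, fderiv ℝ (fun y => fderiv ℝ F y (Jc y v)) y u =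
      fderiv ℝ (fderiv ℝ F) y u (Jc y v) - fderiv ℝ F y (Γ y u (Jc y v))
        + fderiv ℝ F y (Jc y (Γ y u v)) := by
    filter_upwards [hFd, hJd, hpar] with y hy hyJ hp u v
    have e : fderiv ℝ Jc y u v = Jc y (Γ y u v) - Γ y u (Jc y v) := by
      have := hp u v
      rw [sub_eq_zero] at this
      exact eq_sub_of_add_eq this
    rw [fderiv_clm_apply hy (hyJ.clm_apply (differentiableAt_const v)),
      fderiv_clm_apply hyJ (differentiableAt_const v)]
    simp [e]
    abel
  -- This is `⟨∇_u v, w⟩ = ⟨∇_u (Jv), Jw⟩` for constant `v, w`. It holds near `z`, so it can be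
  -- differentiated in `u'` and antisymmetrized in `u, u'`; no curvature tensor is needed.
  have heq : ∀ u v w, (fun y => ⟪fderiv ℝ (fun y => fderiv ℝ F y v) y u, fderiv ℝ F y w⟫_ℝ)
      =ᶠ[nhds z] fun y => ⟪fderiv ℝ (fun y => fderiv ℝ F y (Jc y v)) y u,
        fderiv ℝ F y (Jc y w)⟫_ℝ := by
    intro u v w
    filter_upwards [dE, dP, hΓ, horth] with y h1 h2 h3 h4
    rw [h1, h2, inner_add_left, inner_sub_left, h3, h3, h4]
    ring
  have k1 := fderiv_inner_fderiv_sub (hE v) ((hE w).of_le (by norm_num)) u u'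
  have k2 := fderiv_inner_fderiv_sub (hP v) ((hP w).of_le (by norm_num)) u u'
  rw [(heq u v w).fderiv_eq, (heq u' v w).fderiv_eq, k2] at k1
  have hEz := dE.self_of_nhds
  have hPz := dP.self_of_nhds
  have hΓz := hΓ.self_of_nhds
  have hoz := horth.self_of_nhds
  have ha : ∀ u v, a u v = fderiv ℝ (fderiv ℝ F) z u v - fderiv ℝ F z (Γ z u v) := by
    intro u v
    rw [hα]
    refine starProjection_orthogonal_eq_sub ⟨_, rfl⟩ ?_
    rintro _ ⟨w, rfl⟩
    change ⟪_, fderiv ℝ F z w⟫_ℝ = 0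
    rw [inner_sub_left, hΓz, sub_self]
  have hat : ∀ u v w, ⟪a u v, fderiv ℝ F z w⟫_ℝ = 0 := by
    intro u v w
    rw [ha, inner_sub_left, hΓz, sub_self]
  have hat' : ∀ u v w, ⟪fderiv ℝ F z w, a u v⟫_ℝ = 0 := fun u v w => by
    rw [real_inner_comm, hat]
  have hD : ∀ u v, fderiv ℝ (fderiv ℝ F) z u v = a u v + fderiv ℝ F z (Γ z u v) := by
    intro u v
    rw [ha, sub_add_cancel]
  simp only [hEz, hPz] at k1
  -- Normal and tangential parts separate; the tangential products agree on both sides because `Jc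
  -- z` is orthogonal, so only the terms in `a` survive.
  simp only [hD, add_sub_cancel_right, inner_add_left, inner_add_right, hat, hat', hoz] at k1
  linarith

end Local

/-! ### Transfer to the manifold and the nullity argument -/

section Geometry

variable {m q : ℕ} {M : Type*} [TopologicalSpace M] [ChartedSpace (Euc m) M]
  [IsManifold 𝓘(ℝ, Euc m) ∞ M]

theorem isManifold_one (m : ℕ) (M : Type*) [TopologicalSpace M] [ChartedSpace (Euc m) M]
    [IsManifold 𝓘(ℝ, Euc m) ∞ M] : IsManifold 𝓘(ℝ, Euc m) 1 M :=
  IsManifold.of_le (n := ∞) (by norm_num)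

omit [IsManifold 𝓘(ℝ, Euc m) ∞ M] in
theorem target_mem_nhds {x₀ : M} {z : Euc m}
    (hz : z ∈ (extChartAt 𝓘(ℝ, Euc m) x₀).target) :
    (extChartAt 𝓘(ℝ, Euc m) x₀).target ∈ nhds z :=
  (isOpen_extChartAt_target x₀).mem_nhds hz

theorem contMDiffAt_param {x₀ : M} {z : Euc m}
    (hz : z ∈ (extChartAt 𝓘(ℝ, Euc m) x₀).target) :
    ContMDiffAt 𝓘(ℝ, Euc m) 𝓘(ℝ, Euc m) ∞ (extChartAt 𝓘(ℝ, Euc m) x₀).symm z :=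
  (contMDiffOn_extChartAt_symm x₀).contMDiffAt (target_mem_nhds hz)

theorem dChart_dParam {x₀ : M} {z : Euc m} (hz : z ∈ (extChartAt 𝓘(ℝ, Euc m) x₀).target)
    (v : Euc m) : dChart x₀ ((extChartAt 𝓘(ℝ, Euc m) x₀).symm z) (dParam x₀ z v) = v := by
  have := isManifold_one m M
  have h := mfderiv_extChartAt_comp_mfderivWithin_extChartAt_symm hz
  rw [ModelWithCorners.range_eq_univ, mfderivWithin_univ] at h
  exact congrArg (fun L => L v) h

theorem dParam_dChart {x₀ : M} {z : Euc m} (hz : z ∈ (extChartAt 𝓘(ℝ, Euc m) x₀).target)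
    (X : Tan m ((extChartAt 𝓘(ℝ, Euc m) x₀).symm z)) :
    dParam x₀ z (dChart x₀ ((extChartAt 𝓘(ℝ, Euc m) x₀).symm z) X) = X := by
  have := isManifold_one m M
  have h := mfderivWithin_extChartAt_symm_comp_mfderiv_extChartAt hz
  rw [ModelWithCorners.range_eq_univ, mfderivWithin_univ] at h
  exact congrArg (fun L => L X) h

theorem endInChart_dChart (J : ∀ x : M, Tan m x →L[ℝ] Tan m x) {x₀ : M} {z : Euc m}
    (hz : z ∈ (extChartAt 𝓘(ℝ, Euc m) x₀).target)
    (X : Tan m ((extChartAt 𝓘(ℝ, Euc m) x₀).symm z)) :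
    endInChart J x₀ z (dChart x₀ ((extChartAt 𝓘(ℝ, Euc m) x₀).symm z) X) =
      dChart x₀ ((extChartAt 𝓘(ℝ, Euc m) x₀).symm z) (J _ X) := by
  change dChart x₀ _ (J _ (dParam x₀ z (dChart x₀ _ X))) = _
  rw [dParam_dChart hz]

theorem endInChart_dChart_self (J : ∀ x : M, Tan m x →L[ℝ] Tan m x) (x : M) (X : Tan m x) :
    endInChart J x (extChartAt 𝓘(ℝ, Euc m) x x) (dChart x x X) = dChart x x (J x X) := by
  have hz := mem_extChartAt_target (I := 𝓘(ℝ, Euc m)) x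
  -- `ψ(φ(x)) = x` is not definitional and the tangent spaces depend on the point, so the base point
  -- is generalized before substituting.
  have h : ∀ y, y = (extChartAt 𝓘(ℝ, Euc m) x).symm (extChartAt 𝓘(ℝ, Euc m) x x) →
      ∀ X : Tan m y, endInChart J x (extChartAt 𝓘(ℝ, Euc m) x x) (dChart x y X) =
        dChart x y (J y X) := by
    rintro y rfl X
    exact endInChart_dChart J hz X
  exact h x (extChartAt_to_inv x).symm X

theorem contDiffAt_endInChart {J : ∀ x : M, Tan m x →L[ℝ] Tan m x}
    (hJ : ContMDiff 𝓘(ℝ, Euc m) (𝓘(ℝ, Euc m).prod 𝓘(ℝ, Euc m →L[ℝ] Euc m)) ∞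
      (fun x : M => TotalSpace.mk' (Euc m →L[ℝ] Euc m)
        (E := fun x : M => Tan m x →L[ℝ] Tan m x) x (J x))) (x₀ : M) :
    ContDiffAt ℝ ∞ (endInChart J x₀) (extChartAt 𝓘(ℝ, Euc m) x₀ x₀) := by
  have := isManifold_one m M
  have hz := mem_extChartAt_target (I := 𝓘(ℝ, Euc m)) x₀
  have h := ((contMDiffAt_hom_bundle _).1 (hJ x₀)).2
  have h2 := ContMDiffAt.comp_of_eq (g := _) h (contMDiffAt_param hz) (extChartAt_to_inv x₀)
  refine (contMDiffAt_iff_contDiffAt.1 h2).congr_of_eventuallyEq ?_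
  filter_upwards [target_mem_nhds hz] with z hz
  have hs : (extChartAt 𝓘(ℝ, Euc m) x₀).symm z ∈ (chartAt (Euc m) x₀).source := by
    simpa using (extChartAt 𝓘(ℝ, Euc m) x₀).map_target hz
  have e1 := TangentBundle.continuousLinearMapAt_trivializationAt (I := 𝓘(ℝ, Euc m)) hs
  have e2 := TangentBundle.symmL_trivializationAt (I := 𝓘(ℝ, Euc m)) hs
  rw [ModelWithCorners.range_eq_univ, mfderivWithin_univ,
    (extChartAt 𝓘(ℝ, Euc m) x₀).right_inv hz] at e2
  simp only [Function.comp, ContinuousLinearMap.inCoordinates]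
  erw [e1, e2]
  rfl

theorem fderiv_comp_param {f : M → Euc q} (hf : ContMDiff 𝓘(ℝ, Euc m) 𝓘(ℝ, Euc q) ∞ f) {x₀ : M}
    {z : Euc m} (hz : z ∈ (extChartAt 𝓘(ℝ, Euc m) x₀).target) (v : Euc m) :
    fderiv ℝ (f ∘ (extChartAt 𝓘(ℝ, Euc m) x₀).symm) z v = diff f _ (dParam x₀ z v) := by
  rw [← mfderiv_eq_fderiv, mfderiv_comp z ((hf _).mdifferentiableAt (by simp))
    ((contMDiffAt_param hz).mdifferentiableAt (by simp))]
  rfl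

theorem contDiffAt_comp_param {f : M → Euc q} (hf : ContMDiff 𝓘(ℝ, Euc m) 𝓘(ℝ, Euc q) ∞ f) {x₀ : M}
    {z : Euc m} (hz : z ∈ (extChartAt 𝓘(ℝ, Euc m) x₀).target) :
    ContDiffAt ℝ ∞ (f ∘ (extChartAt 𝓘(ℝ, Euc m) x₀).symm) z :=
  contMDiffAt_iff_contDiffAt.1 ((hf _).comp z (contMDiffAt_param hz))

variable {g : Metric m M} {f : M → Euc q}

theorem metricInChart_eq (hf : IsIsometricImmersion g f) {x₀ : M} {z : Euc m}
    (hz : z ∈ (extChartAt 𝓘(ℝ, Euc m) x₀).target) (v w : Euc m) :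
    metricInChart g x₀ z v w = ⟪fderiv ℝ (f ∘ (extChartAt 𝓘(ℝ, Euc m) x₀).symm) z v,
      fderiv ℝ (f ∘ (extChartAt 𝓘(ℝ, Euc m) x₀).symm) z w⟫_ℝ := by
  rw [fderiv_comp_param hf.smooth hz, fderiv_comp_param hf.smooth hz, hf.isometric]
  rfl

/-- `ContinuousLinearMap.inverse` is zero on non-invertible maps, so `christoffel` has its intended
meaning only through this fact. -/
theorem metricInChart_isInvertible {x₀ : M} {z : Euc m}
    (hz : z ∈ (extChartAt 𝓘(ℝ, Euc m) x₀).target) :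
    (metricInChart g x₀ z).IsInvertible := by
  have hinj : Function.Injective (metricInChart g x₀ z) := by
    rw [injective_iff_map_eq_zero]
    intro v hv
    by_contra hne
    have h1 : dParam x₀ z v ≠ 0 := fun h => hne (by rw [← dChart_dParam hz v, h, map_zero])
    have h2 := g.pos _ _ h1
    have h3 : metricInChart g x₀ z v v = 0 := by rw [hv]; rfl
    exact h2.ne' h3
  have hd : Module.finrank ℝ (Euc m) = Module.finrank ℝ (Euc m →L[ℝ] ℝ) := by
    rw [← (LinearMap.toContinuousLinearMap : (Euc m →ₗ[ℝ] ℝ) ≃ₗ[ℝ] _).finrank_eq]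
    exact Subspace.dual_finrank_eq.symm
  refine ⟨(LinearEquiv.ofInjectiveOfFinrankEq (metricInChart g x₀ z).toLinearMap hinj
    hd).toContinuousLinearEquiv, ?_⟩
  ext v w
  rfl

/-- Koszul's computation: differentiate `G(v, w) = ⟨dF v, dF w⟩`; by symmetry of `D²F`, the
Christoffel combination cancels all but `⟨D²F(u, v), dF w⟩`. -/
theorem inner_fderiv_christoffel (hf : IsIsometricImmersion g f) {x₀ : M} {z : Euc m}
    (hz : z ∈ (extChartAt 𝓘(ℝ, Euc m) x₀).target) (u v w : Euc m) :
    ⟪fderiv ℝ (fderiv ℝ (f ∘ (extChartAt 𝓘(ℝ, Euc m) x₀).symm)) z u v,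
        fderiv ℝ (f ∘ (extChartAt 𝓘(ℝ, Euc m) x₀).symm) z w⟫_ℝ =
      ⟪fderiv ℝ (f ∘ (extChartAt 𝓘(ℝ, Euc m) x₀).symm) z (christoffel g x₀ z u v),
        fderiv ℝ (f ∘ (extChartAt 𝓘(ℝ, Euc m) x₀).symm) z w⟫_ℝ := by
  rw [← metricInChart_eq hf hz, christoffel,
    (metricInChart_isInvertible hz).self_apply_inverse]
  set F := f ∘ (extChartAt 𝓘(ℝ, Euc m) x₀).symm with hFdef
  have hF : ContDiffAt ℝ 2 F z := (contDiffAt_comp_param hf.smooth hz).of_le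
    ENat.LEInfty.out
  have hd : DifferentiableAt ℝ (fderiv ℝ F) z :=
    (hF.fderiv_right (m := 1) (by norm_num)).differentiableAt (by norm_num)
  have hs : IsSymmSndFDerivAt ℝ F z := hF.isSymmSndFDerivAt (by simp)
  have key : ∀ a b c : Euc m, fderiv ℝ (fun y => metricInChart g x₀ y a b) z c =
      ⟪fderiv ℝ F z a, fderiv ℝ (fderiv ℝ F) z c b⟫_ℝ +
        ⟪fderiv ℝ (fderiv ℝ F) z c a, fderiv ℝ F z b⟫_ℝ := by
    intro a b c
    have e : (fun y => metricInChart g x₀ y a b) =ᶠ[nhds z]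
        fun y => ⟪fderiv ℝ F y a, fderiv ℝ F y b⟫_ℝ := by
      filter_upwards [target_mem_nhds hz] with y hy using metricInChart_eq hf hy a b
    rw [e.fderiv_eq, fderiv_inner_apply ℝ (hd.clm_apply (differentiableAt_const a))
      (hd.clm_apply (differentiableAt_const b)),
      fderiv_clm_apply hd (differentiableAt_const a), fderiv_clm_apply hd (differentiableAt_const b)]
    simp
  have hG : DifferentiableAt ℝ (metricInChart g x₀) z := by
    have e : metricInChart g x₀ =ᶠ[nhds z] fun y =>
        ((ContinuousLinearMap.compL ℝ (Euc m) (Euc q) ℝ).flip (fderiv ℝ F y)).comp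
          ((innerSL ℝ).comp (fderiv ℝ F y)) := by
      filter_upwards [target_mem_nhds hz] with y hy
      ext v w
      exact metricInChart_eq hf hy v w
    exact (differentiableAt_inner_pullback hd).congr_of_eventuallyEq e
  have hG1 : ∀ a b c : Euc m, fderiv ℝ (fun y => metricInChart g x₀ y a) z c b =
      fderiv ℝ (fun y => metricInChart g x₀ y a b) z c := by
    intro a b c
    rw [fderiv_clm_apply (hG.clm_apply (differentiableAt_const a)) (differentiableAt_const b)]
    simp
  simp only [christoffelFirst, smul_apply, add_apply, sub_apply, hG1, key, smul_eq_mul]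
  have e1 := real_inner_comm (fderiv ℝ F z v) (fderiv ℝ (fderiv ℝ F) z u w)
  have e2 := real_inner_comm (fderiv ℝ F z u) (fderiv ℝ (fderiv ℝ F) z v w)
  rw [hs.eq v u, hs.eq w u, hs.eq w v]
  linarith

/-- The Gauss equation of a Kaehler submanifold of Euclidean space. -/
theorem IsKaehler.isKaehlerFlat {J : ∀ x : M, Tan m x →L[ℝ] Tan m x} (hK : IsKaehler g J)
    (hf : IsIsometricImmersion g f) (x : M) :
    IsKaehlerFlat (secondFundamentalForm (m := m) f x) (J x).toLinearMap := by
  have hz := mem_extChartAt_target (I := 𝓘(ℝ, Euc m)) x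
  have hF := contDiffAt_comp_param hf.smooth hz
  have hrange : LinearMap.range (fderiv ℝ (f ∘ (extChartAt 𝓘(ℝ, Euc m) x).symm)
      (extChartAt 𝓘(ℝ, Euc m) x x)).toLinearMap =
      LinearMap.range (diff (m := m) f x).toLinearMap := by
    have h : ∀ y, y = (extChartAt 𝓘(ℝ, Euc m) x).symm (extChartAt 𝓘(ℝ, Euc m) x x) →
        LinearMap.range (fderiv ℝ (f ∘ (extChartAt 𝓘(ℝ, Euc m) x).symm)
          (extChartAt 𝓘(ℝ, Euc m) x x)).toLinearMap =
        LinearMap.range (diff (m := m) f y).toLinearMap := by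
      rintro y rfl
      apply le_antisymm
      · rintro _ ⟨v, rfl⟩
        exact ⟨_, (fderiv_comp_param hf.smooth hz v).symm⟩
      · rintro _ ⟨X, rfl⟩
        refine ⟨dChart x _ X, (fderiv_comp_param hf.smooth hz _).trans ?_⟩
        rw [dParam_dChart hz]
        rfl
    exact h x (extChartAt_to_inv x).symm
  intro X Y Z W
  have := kaehler_gauss_of_local (F := f ∘ (extChartAt 𝓘(ℝ, Euc m) x).symm)
    (Jc := endInChart J x) (Γ := christoffel g x) (z := extChartAt 𝓘(ℝ, Euc m) x x)
    (hF.of_le ENat.LEInfty.out)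
    ((contDiffAt_endInChart hK.smooth x).of_le ENat.LEInfty.out)
    (by
      filter_upwards [target_mem_nhds hz] with y hy v w
      rw [← metricInChart_eq hf hy, ← metricInChart_eq hf hy, ← dChart_dParam hy v,
        ← dChart_dParam hy w, endInChart_dChart J hy, endInChart_dChart J hy]
      change g.inner _ (dParam x y (dChart x _ _)) (dParam x y (dChart x _ _)) =
        g.inner _ (dParam x y (dChart x _ _)) (dParam x y (dChart x _ _))
      simp only [dParam_dChart hy]
      exact hK.orthogonal _ _ _)
    (by
      filter_upwards [target_mem_nhds hz] with y hy u v w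
      exact inner_fderiv_christoffel hf hy u v w)
    (by
      filter_upwards [target_mem_nhds hz] with y hy u v
      exact hK.parallel x y hy u v)
    (a := fun u v => (normalSpace m f x).starProjection
      (fderiv ℝ (fderiv ℝ (f ∘ (extChartAt 𝓘(ℝ, Euc m) x).symm)) (extChartAt 𝓘(ℝ, Euc m) x x) u v))
    (by
      intro u v
      simp only [hrange]
      rfl)
    (dChart x x X) (dChart x x Y) (dChart x x Z) (dChart x x W)
  simp only [endInChart_dChart_self] at this
  exact this

theorem secondFundamentalForm_symm (hf : ContMDiff 𝓘(ℝ, Euc m) 𝓘(ℝ, Euc q) ∞ f) (x : M)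
    (X Y : Tan m x) :
    secondFundamentalForm f x X Y = secondFundamentalForm f x Y X := by
  have hF : ContDiffAt ℝ 2 _ _ := (contDiffAt_comp_param hf
    (mem_extChartAt_target (I := 𝓘(ℝ, Euc m)) x)).of_le ENat.LEInfty.out
  have hs := hF.isSymmSndFDerivAt (by simp)
  exact congrArg (normalSpace m f x).starProjection (hs.eq (dChart x x X) (dChart x x Y))

omit [IsManifold 𝓘(ℝ, Euc m) ∞ M] in
theorem secondFundamentalForm_mem_normalSpace (f : M → Euc q) (x : M) (X Y : Tan m x) :
    secondFundamentalForm f x X Y ∈ normalSpace m f x :=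
  Submodule.starProjection_apply_mem _ _

theorem finrank_normalSpace (hf : IsIsometricImmersion g f) (x : M) :
    Module.finrank ℝ (normalSpace m f x) + m = q := by
  have : FiniteDimensional ℝ (Tan m x) := inferInstanceAs (FiniteDimensional ℝ (Euc m))
  have hinj : LinearMap.ker (diff (m := m) f x).toLinearMap = ⊥ := by
    rw [LinearMap.ker_eq_bot']
    intro X hX
    by_contra hne
    have h := hf.isometric x X X
    have h2 : diff f x X = 0 := hX
    rw [h2, inner_zero_left] at h
    exact (g.pos x X hne).ne h
  have h1 := LinearMap.finrank_range_add_finrank_ker (diff (m := m) f x).toLinearMap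
  have h2 := Submodule.finrank_add_finrank_orthogonal (LinearMap.range (diff (m := m) f x).toLinearMap)
  have h3 : Module.finrank ℝ (Tan m x) = m := finrank_euclideanSpace_fin (𝕜 := ℝ)
  rw [hinj, finrank_bot] at h1
  rw [finrank_euclideanSpace_fin] at h2
  change _ + Module.finrank ℝ (normalSpace m f x) = _ at h2
  omega

omit [IsManifold 𝓘(ℝ, Euc m) ∞ M] in
theorem le_complexNullity {J : ∀ x : M, Tan m x →L[ℝ] Tan m x}
    (hJ : ∀ x X, J x (J x X) = -X) {x : M} {U : Submodule ℝ (Euc q)} (hU : U ≤ normalSpace m f x)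
    {K : Submodule ℝ (Tan m x)} (hKJ : ∀ Y ∈ K, J x Y ∈ K) (hK : K ≤ nullSpace f x U) :
    Module.finrank ℝ K ≤ complexNullity J f (Module.finrank ℝ U) x := by
  have : FiniteDimensional ℝ (Tan m x) := inferInstanceAs (FiniteDimensional ℝ (Euc m))
  have hle : K ≤ nullSpace f x U ⊓ (nullSpace f x U).map (J x).toLinearMap := by
    refine le_inf hK fun Y hY => ⟨-J x Y, neg_mem (hK (hKJ Y hY)), ?_⟩
    change J x (-J x Y) = Y
    rw [map_neg, hJ, neg_neg]
  -- The supremum in `ℕ` dominates its members only for a set bounded above; `dim T_x M` is a bound.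
  refine (Submodule.finrank_mono hle).trans (le_csSup ⟨Module.finrank ℝ (Tan m x), ?_⟩
    ⟨U, hU, rfl, rfl⟩)
  rintro _ ⟨U, -, -, rfl⟩
  exact Submodule.finrank_le _

omit [IsManifold 𝓘(ℝ, Euc m) ∞ M] in
theorem mem_nullSpace_of_inner {x : M} {U : Submodule ℝ (Euc q)} {Y : Tan m x}
    (h : ∀ Z, ∀ u ∈ U, ⟪u, secondFundamentalForm f x Y Z⟫_ℝ = 0) : Y ∈ nullSpace f x U := by
  rw [nullSpace, LinearMap.mem_ker]
  ext1 Z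
  exact (Submodule.starProjection_apply_eq_zero_iff U).2 ((Submodule.mem_orthogonal _ _).2 (h Z))

theorem hermitianPart_eq_zero {J : ∀ x : M, Tan m x →L[ℝ] Tan m x} (hK : IsKaehler g J)
    (hf : IsIsometricImmersion g f) (x : M)
    (hν : ∀ s : ℕ, 1 ≤ s → s + m ≤ q → complexNullity J f s x + 2 * s < m) (X Y : Tan m x) :
    hermitianPart (secondFundamentalForm f x) (J x).toLinearMap X Y = 0 := by
  have : FiniteDimensional ℝ (Tan m x) := inferInstanceAs (FiniteDimensional ℝ (Euc m))
  have hs := secondFundamentalForm_symm hf.smooth x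
  have hflat := hK.isKaehlerFlat hf x
  have hJ : ∀ X, (J x).toLinearMap ((J x).toLinearMap X) = -X := hK.sq x
  set U := hermitianSpan (secondFundamentalForm f x) (J x).toLinearMap with hUdef
  have hU : U ≤ normalSpace m f x := by
    refine Submodule.span_le.2 ?_
    rintro _ ⟨X, rfl⟩
    exact add_mem (secondFundamentalForm_mem_normalSpace f x _ _)
      (secondFundamentalForm_mem_normalSpace f x _ _)
  obtain ⟨K, hKJ, hK0, hdim⟩ := hflat.exists_hermitianKer hs hJ
  rw [← hUdef] at hdim
  have hKn : K ≤ nullSpace f x U := by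
    intro Y hY
    refine mem_nullSpace_of_inner fun Z u hu => ?_
    rw [hs]
    exact hflat.inner_hermitianSpan hs hJ (fun X => hK0 X Y hY)
      (fun X => hK0 X _ (hKJ Y hY)) Z hu
  have hle := le_complexNullity hK.sq hU hKJ hKn
  have h3 : Module.finrank ℝ (Tan m x) = m := finrank_euclideanSpace_fin (𝕜 := ℝ)
  have hUle := Submodule.finrank_mono hU
  have hN := finrank_normalSpace hf x
  refine hermitianPart_eq_zero_of_span hs (Submodule.finrank_eq_zero.1 ?_) X Y
  -- If `s = dim U ≥ 1`, then `s ≤ dim N_f M(x) = q - m`, so `hν` applies and contradicts `m ≤ dim K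
  -- + 2s`.
  by_contra hne
  have := hν (Module.finrank ℝ U) (Nat.one_le_iff_ne_zero.2 hne) (by omega)
  omega

end Geometry

/-! ### Invariance of the metric trace under isometries -/

section Trace

variable {E : Type*} [AddCommGroup E] [Module ℝ E]

/-- The trace of a bilinear form with respect to a symmetric invertible matrix `G` is invariant
under changes of basis which preserve `G`. -/
theorem sum_inv_smul_comp_eq {ι : Type*} [Fintype ι] [DecidableEq ι] {V : Type*} [AddCommGroup V]
    [Module ℝ V] (b : Module.Basis ι ℝ V) (α : V →ₗ[ℝ] V →ₗ[ℝ] E) (J : V →ₗ[ℝ] V)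
    (G : Matrix ι ι ℝ) (hG : IsUnit G.det)
    (hJ : (LinearMap.toMatrix b b J).transpose * G * LinearMap.toMatrix b b J = G) :
    ∑ i, ∑ j, G⁻¹ i j • α (J (b i)) (J (b j)) = ∑ i, ∑ j, G⁻¹ i j • α (b i) (b j) := by
  set A := LinearMap.toMatrix b b J with hA
  -- `Aᵀ G A = G` makes `G⁻¹ Aᵀ G` a left inverse of `A`, hence for square matrices also a right
  -- inverse.
  have hinv : A * G⁻¹ * A.transpose = G⁻¹ := by
    have h1 : (G⁻¹ * A.transpose * G) * A = 1 := by
      rw [Matrix.mul_assoc, Matrix.mul_assoc, ← Matrix.mul_assoc A.transpose, hJ,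
        Matrix.nonsing_inv_mul _ hG]
    have h2 := mul_eq_one_comm.1 h1
    calc A * G⁻¹ * A.transpose = (A * (G⁻¹ * A.transpose * G)) * G⁻¹ := by
          simp only [Matrix.mul_assoc]
          rw [Matrix.mul_nonsing_inv _ hG, Matrix.mul_one]
      _ = G⁻¹ := by rw [h2, Matrix.one_mul]
  have hb : ∀ i, J (b i) = ∑ k, A k i • b k := fun i => by
    rw [hA, ← Matrix.toLin_self b b, Matrix.toLin_toMatrix]
  calc ∑ i, ∑ j, G⁻¹ i j • α (J (b i)) (J (b j))
      = ∑ i, ∑ j, ∑ k, ∑ l, (A k i * G⁻¹ i j * A l j) • α (b k) (b l) := by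
        refine Finset.sum_congr rfl fun i _ => Finset.sum_congr rfl fun j _ => ?_
        rw [hb, hb]
        simp only [map_sum, map_smul, LinearMap.sum_apply, LinearMap.smul_apply, Finset.smul_sum,
          smul_smul]
        rw [Finset.sum_comm]
        refine Finset.sum_congr rfl fun k _ => Finset.sum_congr rfl fun l _ => ?_
        congr 1
        ring
    _ = ∑ k, ∑ l, ∑ i, ∑ j, (A k i * G⁻¹ i j * A l j) • α (b k) (b l) := by
        simp only [← Fintype.sum_prod_type']
        exact Fintype.sum_equiv ((Equiv.prodAssoc _ _ _).symm.trans ((Equiv.prodComm _ _).trans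
          (Equiv.prodAssoc _ _ _))) _ _ fun _ => rfl
    _ = ∑ k, ∑ l, (A * G⁻¹ * A.transpose) k l • α (b k) (b l) := by
        refine Finset.sum_congr rfl fun k _ => Finset.sum_congr rfl fun l _ => ?_
        simp only [Matrix.mul_apply, Matrix.transpose_apply, Finset.sum_mul, Finset.sum_smul]
        rw [Finset.sum_comm]
    _ = _ := by rw [hinv]

end Trace

/-! ### Vanishing of the mean curvature -/

section Mean

variable {m q : ℕ} {M : Type*} [TopologicalSpace M] [ChartedSpace (Euc m) M]
  [IsManifold 𝓘(ℝ, Euc m) ∞ M] {g : Metric m M}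

theorem metric_inner_eq_gram (g : Metric m M) (x : M) (X Y : Euc m) :
    g.inner x X Y = X.ofLp ⬝ᵥ (gram g x).mulVec Y.ofLp := by
  have hX : X = ∑ i, X i • (EuclideanSpace.single i (1 : ℝ) : Euc m) := by
    ext j
    simp [Finset.sum_apply, Pi.single_apply]
  have hY : Y = ∑ i, Y i • (EuclideanSpace.single i (1 : ℝ) : Euc m) := by
    ext j
    simp [Finset.sum_apply, Pi.single_apply]
  let B : Euc m →L[ℝ] Euc m →L[ℝ] ℝ := g.inner x
  change B X Y = _
  conv_lhs => rw [hX, hY]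
  simp only [map_sum, map_smul, sum_apply, smul_apply, dotProduct, Matrix.mulVec, smul_eq_mul,
    Finset.mul_sum]
  rw [Finset.sum_comm]
  refine Finset.sum_congr rfl fun i _ => Finset.sum_congr rfl fun j _ => ?_
  rw [mul_comm (Y j), mul_assoc]
  rfl

theorem isUnit_det_gram (g : Metric m M) (x : M) : IsUnit (gram g x).det := by
  rw [isUnit_iff_ne_zero]
  intro h
  obtain ⟨v, hv, h0⟩ := Matrix.exists_mulVec_eq_zero_iff.2 h
  have hne : (WithLp.toLp 2 v : Euc m) ≠ 0 := fun e => hv (by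
    have := congrArg WithLp.ofLp e
    simpa using this)
  have h1 := g.pos x (WithLp.toLp 2 v : Euc m) hne
  rw [metric_inner_eq_gram, h0, dotProduct_zero] at h1
  exact lt_irrefl _ h1

theorem IsKaehler.toMatrix_conj_gram {J : ∀ x : M, Tan m x →L[ℝ] Tan m x} (hK : IsKaehler g J)
    (x : M) (A : Euc m →ₗ[ℝ] Euc m) (hA : A = (J x).toLinearMap) :
    (LinearMap.toMatrix (EuclideanSpace.basisFun (Fin m) ℝ).toBasis
        (EuclideanSpace.basisFun (Fin m) ℝ).toBasis A).transpose * gram g x *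
      LinearMap.toMatrix (EuclideanSpace.basisFun (Fin m) ℝ).toBasis
        (EuclideanSpace.basisFun (Fin m) ℝ).toBasis A = gram g x := by
  ext i j
  have h := hK.orthogonal x (EuclideanSpace.single i (1 : ℝ) : Euc m)
    (EuclideanSpace.single j (1 : ℝ) : Euc m)
  have hJ : ∀ v : Euc m, J x v = A v := fun v => by rw [hA]; rfl
  rw [hJ, hJ, metric_inner_eq_gram] at h
  change _ = gram g x i j at h
  rw [← h, Matrix.mul_assoc, Matrix.mul_apply]
  simp [dotProduct, Matrix.mul_apply, Matrix.mulVec, LinearMap.toMatrix_apply]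

theorem isMinimal_of_hermitianPart_eq_zero {J : ∀ x : M, Tan m x →L[ℝ] Tan m x}
    (hK : IsKaehler g J) {f : M → Euc q} (h : ∀ x (X Y : Tan m x),
      hermitianPart (secondFundamentalForm f x) (J x).toLinearMap X Y = 0) :
    IsMinimal g f := by
  intro x
  let A : Euc m →ₗ[ℝ] Euc m := (J x).toLinearMap
  let a : Euc m →ₗ[ℝ] Euc m →ₗ[ℝ] Euc q := secondFundamentalForm f x
  have key := sum_inv_smul_comp_eq (EuclideanSpace.basisFun (Fin m) ℝ).toBasis a A (gram g x)
    (isUnit_det_gram g x) (hK.toMatrix_conj_gram x A rfl)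
  have hn : ∀ X Y : Euc m, a (A X) (A Y) = -a X Y := fun X Y =>
    eq_neg_of_add_eq_zero_right (h x X Y)
  -- The trace now equals its own negative.
  simp only [hn, smul_neg, Finset.sum_neg_distrib] at key
  have h0 := (smul_eq_zero.1 ((two_smul ℝ _).trans (eq_neg_iff_add_eq_zero.1 key.symm))).resolve_left
    two_ne_zero
  rw [meanCurvature]
  convert smul_zero _
  simp only [OrthonormalBasis.coe_toBasis, EuclideanSpace.basisFun_apply] at h0
  exact h0

end Mean

end RealKaehler

theorem theorem1 (n p : ℕ)
    {M : Type*} [TopologicalSpace M] [ChartedSpace (RealKaehler.Euc (2 * n)) M]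
    [IsManifold 𝓘(ℝ, RealKaehler.Euc (2 * n)) ∞ M]
    (g : RealKaehler.Metric (2 * n) M)
    (J : ∀ x : M, RealKaehler.Tan (2 * n) x →L[ℝ] RealKaehler.Tan (2 * n) x)
    (hK : RealKaehler.IsKaehler g J)
    (f : M → RealKaehler.Euc (2 * n + p))
    (hf : RealKaehler.IsIsometricImmersion g f)
    (hν : ∀ (x : M) (s : ℕ), 1 ≤ s → s ≤ p →
      (RealKaehler.complexNullity J f s x : ℤ) < 2 * ((n : ℤ) - (s : ℤ))) :
    RealKaehler.IsMinimal g f ∧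
      ∀ (x : M) (X Y : RealKaehler.Tan (2 * n) x),
        RealKaehler.secondFundamentalForm f x X (J x Y) =
          RealKaehler.secondFundamentalForm f x (J x X) Y := by
  have h0 : ∀ x (X Y : RealKaehler.Tan (2 * n) x), RealKaehler.hermitianPart
      (RealKaehler.secondFundamentalForm f x) (J x).toLinearMap X Y = 0 := fun x =>
    RealKaehler.hermitianPart_eq_zero hK hf x fun s h1 h2 => by
      have := hν x s h1 (by omega)
      omega
  refine ⟨RealKaehler.isMinimal_of_hermitianPart_eq_zero hK h0, fun x X Y => ?_⟩
  have h1 : RealKaehler.secondFundamentalForm f x X (J x Y) +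
      RealKaehler.secondFundamentalForm f x (J x X) (J x (J x Y)) = 0 := h0 x X (J x Y)
  rw [hK.sq, map_neg, ← sub_eq_add_neg] at h1
  exact sub_eq_zero.1 h1
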